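/- Let $g, m_{UAV}, m_{PL}, H_{xx}, H_{yy}, q_1, q_2 > 0$ and $m_{\rm tot} = m_{UAV}+m_{PL}$. For real vertical positions $z_{POI}$ (controlled output) and $z_{PL}$ (payload) put $$\alpha = z_{POI} - \tfrac{m_{PL}}{m_{\rm tot}} z_{PL},\quad b_1 = m_{PL}m_{UAV}z_{PL}^2 + H_{yy} m_{\rm tot},\quad b_2 = m_{PL}m_{UAV}z_{PL}^2 + H_{xx} m_{\rm tot},\quad \hat q_i = \tfrac{b_i}{m_{\rm tot}} q_i .$$ The linearized dynamics of the multirotor with payload, with state $(\dot p, \omega, p, \eta)$, $p=(x,y,z)$ the position of the controlled output, $\eta=(\varphi,\theta,\psi)$ the Euler angles, and with scaled input $(\hat T,\hat\tau_\varphi,\hat\tau_\theta,\hat\tau_\psi)$, are $$\ddot x = g\theta + \alpha\hat\tau_\theta,\quad \ddot y = -g\varphi-\alpha\hat\tau_\varphi,\quad \ddot z = \hat T,\quad \dot\omega = (\hat\tau_\varphi,\hat\tau_\theta,\hat\tau_\psi),\quad \dot\eta=\omega .$$ Its lateral subsystems $\dot x_i = A_i x_i + B_i u_i$, $i\in\{1,2\}$,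 have states $(x,\dot x,\theta,\omega_y)$ and $(y,\dot y,\varphi,\omega_x)$, inputs $\hat\tau_\theta$ and $\hat\tau_\varphi$, and output $y_i = Cx_i$, the first state. Let $u_i = -B_i^\top P_i x_i$ be the linear-quadratic regulator for the cost $\int_0^\infty (\hat q_i^2 y_i^2 + u_i^2)\,dt$, where $P_i$ is the positive semidefinite solution of $A_i^\top P_i + P_iA_i - P_iB_iB_i^\top P_i + \hat q_i^2 C^\top C = 0$. Let $\mathcal H_{2,i}(z_{POI},z_{PL})$ be the $\mathcal H_2$-norm of the closed loop from a disturbance $w$ added to the input to the performance output $(\hat q_i y_i, u_i)$, that is, the $L^2(0,\infty)$-norm of its impulse response. Theorem. Let $i\in\{1,2\}$. 1. For all $z_{POI}, z_{PL}\in\mathbb R$ the matrix $P_i$ exists and is unique, and the impulse response is square integrable on $(0,\infty)$. 2. For every fixed $z_{PL}\in\mathbb R$, the function $z_{POI}\mapsto \mathcal H_{2,i}(z_{POI},z_{PL})$ has a unique global minimizer, the one at which $\alpha = \alpha^* = \sqrt{2g/\hat q_i}$; its minimal value satisfies $\mathcal H_{2,i}^2 = 2\,(2g\hat q_i)^{1/4}$,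 i.e. $\mathcal H_{2,i} = \sqrt{2\,(2g\hat q_i)^{1/4}}$. 3. The function $(z_{POI},z_{PL})\mapsto\mathcal H_{2,i}(z_{POI},z_{PL})$ on $\mathbb R^2$ has a unique global minimizer, namely $z_{PL}^* = 0$ and $z_{POI}^* = \sqrt{2g/\hat q_i}$, where $\hat q_i$ is taken at $z_{PL}=0$. -/

import Mathlib

open Matrix MeasureTheory

/-! ### The linearized multirotor with a rigidly attached payload -/

/-- Physical parameters and output weights. `Hxx`, `Hyy` are the roll and pitch entries of the
(diagonal) total inertia `H_tot`; `q i` is the positive weight of the lateral output of subsystem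
`i`: index `0` is subsystem 1 (`x`-direction, pitch), index `1` is subsystem 2 (`y`-direction, roll). -/
structure UAV where
  g : ℝ
  mUAV : ℝ
  mPL : ℝ
  Hxx : ℝ
  Hyy : ℝ
  q : Fin 2 → ℝ

namespace UAV

/-- Total mass. -/
def mTot (S : UAV) : ℝ := S.mUAV + S.mPL

/-- The inertia entry relevant to subsystem `i`: pitch for `i = 0`, roll for `i = 1`. -/
def inertia (S : UAV) (i : Fin 2) : ℝ := ![S.Hyy, S.Hxx] i

/-- Signed vertical distance `α` from the total center of gravity to the output position. -/
noncomputable def alpha (S : UAV) (zPOI zPL : ℝ) : ℝ := zPOI - S.mPL / S.mTot * zPL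

/-- `b_i = m_PL m_UAV z_PL² + H_i m_tot`. -/
def b (S : UAV) (i : Fin 2) (zPL : ℝ) : ℝ :=
  S.mPL * S.mUAV * zPL ^ 2 + S.inertia i * S.mTot

/-- Scaled output weight `q̂_i = (b_i / m_tot) q_i`. -/
noncomputable def qHat (S : UAV) (i : Fin 2) (zPL : ℝ) : ℝ := S.b i zPL / S.mTot * S.q i

/-- State matrix of the linearized system; the state is
`(ẋ, ẏ, ż, ω_x, ω_y, ω_z, x, y, z, φ, θ, ψ)`, positions being those of the point of interest. -/
def linA (g : ℝ) : Matrix (Fin 12) (Fin 12) ℝ :=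
  !![0, 0, 0, 0, 0, 0, 0, 0, 0, 0, g, 0;
     0, 0, 0, 0, 0, 0, 0, 0, 0, -g, 0, 0;
     0, 0, 0, 0, 0, 0, 0, 0, 0, 0, 0, 0;
     0, 0, 0, 0, 0, 0, 0, 0, 0, 0, 0, 0;
     0, 0, 0, 0, 0, 0, 0, 0, 0, 0, 0, 0;
     0, 0, 0, 0, 0, 0, 0, 0, 0, 0, 0, 0;
     1, 0, 0, 0, 0, 0, 0, 0, 0, 0, 0, 0;
     0, 1, 0, 0, 0, 0, 0, 0, 0, 0, 0, 0;
     0, 0, 1, 0, 0, 0, 0, 0, 0, 0, 0, 0;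
     0, 0, 0, 1, 0, 0, 0, 0, 0, 0, 0, 0;
     0, 0, 0, 0, 1, 0, 0, 0, 0, 0, 0, 0;
     0, 0, 0, 0, 0, 1, 0, 0, 0, 0, 0, 0]

/-- Input matrix of the linearized system; the scaled input is `(T, τ_φ, τ_θ, τ_ψ)`. -/
def linB (α : ℝ) : Matrix (Fin 12) (Fin 4) ℝ :=
  !![0, 0, α, 0;
     0, -α, 0, 0;
     1, 0, 0, 0;
     0, 1, 0, 0;
     0, 0, 1, 0;
     0, 0, 0, 1;
     0, 0, 0, 0;
     0, 0, 0, 0;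
     0, 0, 0, 0;
     0, 0, 0, 0;
     0, 0, 0, 0;
     0, 0, 0, 0]

/-- States of the lateral subsystems: `(x, ẋ, θ, ω_y)` and `(y, ẏ, φ, ω_x)`. -/
def latState (i : Fin 2) : Fin 4 → Fin 12 := ![![6, 0, 10, 4], ![7, 1, 9, 3]] i

/-- Inputs of the lateral subsystems: `τ_θ` and `τ_φ`. -/
def latInput (i : Fin 2) : Fin 1 → Fin 4 := ![![2], ![1]] i

/-- State matrix `A_i` of lateral subsystem `i`. -/
def latA (g : ℝ) (i : Fin 2) : Matrix (Fin 4) (Fin 4) ℝ :=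
  (linA g).submatrix (latState i) (latState i)

/-- Input matrix `B_i` of lateral subsystem `i`. -/
def latB (α : ℝ) (i : Fin 2) : Matrix (Fin 4) (Fin 1) ℝ :=
  (linB α).submatrix (latState i) (latInput i)

/-- The controlled output of a lateral subsystem is the lateral position, its first state. -/
def latC : Matrix (Fin 1) (Fin 4) ℝ := !![1, 0, 0, 0]

theorem latA_zero (g : ℝ) :
    latA g 0 = !![0, 1, 0, 0; 0, 0, g, 0; 0, 0, 0, 1; 0, 0, 0, 0] := by
  ext j k; fin_cases j <;> fin_cases k <;> rfl

theorem latA_one (g : ℝ) :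
    latA g 1 = !![0, 1, 0, 0; 0, 0, -g, 0; 0, 0, 0, 1; 0, 0, 0, 0] := by
  ext j k; fin_cases j <;> fin_cases k <;> rfl

theorem latB_zero (α : ℝ) : latB α 0 = !![0; α; 0; 1] := by
  ext j k; fin_cases j <;> fin_cases k <;> rfl

theorem latB_one (α : ℝ) : latB α 1 = !![0; -α; 0; 1] := by
  ext j k; fin_cases j <;> fin_cases k <;> rfl

/-- The lateral states are not driven by states outside their own subsystem. -/
theorem linA_decoupled (g : ℝ) (i : Fin 2) (j : Fin 4) (k : Fin 12) (hk : ∀ l, latState i l ≠ k) :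
    linA g (latState i j) k = 0 := by
  fin_cases i <;> fin_cases j <;> fin_cases k <;>
    first | rfl | exact absurd rfl (hk 0) | exact absurd rfl (hk 1) |
      exact absurd rfl (hk 2) | exact absurd rfl (hk 3)

/-- The lateral states are not driven by inputs outside their own subsystem. -/
theorem linB_decoupled (α : ℝ) (i : Fin 2) (j k : Fin 4) (hk : latInput i 0 ≠ k) :
    linB α (latState i j) k = 0 := by
  fin_cases i <;> fin_cases j <;> fin_cases k <;> first | rfl | exact absurd rfl hk

end UAV

/-! ### Linear-quadratic control and the `H₂`-norm -/

section Control

variable {n m p : ℕ}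

/-- `P` is a positive semidefinite solution of the algebraic Riccati equation
`Aᵀ P + P A - P B R⁻¹ Bᵀ P + Q = 0` with `R = I`. -/
def IsPSDRiccatiSolution (A : Matrix (Fin n) (Fin n) ℝ) (B : Matrix (Fin n) (Fin m) ℝ)
    (Q P : Matrix (Fin n) (Fin n) ℝ) : Prop :=
  P.PosSemidef ∧ Aᵀ * P + P * A - P * B * Bᵀ * P + Q = 0

/-- The positive semidefinite solution of the Riccati equation (meaningful where it exists
uniquely). -/
noncomputable def riccatiSolution (A : Matrix (Fin n) (Fin n) ℝ) (B : Matrix (Fin n) (Fin m) ℝ)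
    (Q : Matrix (Fin n) (Fin n) ℝ) : Matrix (Fin n) (Fin n) ℝ :=
  Classical.epsilon (IsPSDRiccatiSolution A B Q)

/-- Impulse response `t ↦ C exp(tA) B` of `ẋ = A x + B w`, `z = C x`. -/
noncomputable def impulseResponse (A : Matrix (Fin n) (Fin n) ℝ) (B : Matrix (Fin n) (Fin m) ℝ)
    {ι : Type} (C : Matrix ι (Fin n) ℝ) (t : ℝ) : Matrix ι (Fin m) ℝ :=
  C * NormedSpace.exp (t • A) * B

/-- Squared Frobenius norm of the impulse response at time `t`. -/
noncomputable def impulseEnergy (A : Matrix (Fin n) (Fin n) ℝ) (B : Matrix (Fin n) (Fin m) ℝ)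
    {ι : Type} [Fintype ι] (C : Matrix ι (Fin n) ℝ) (t : ℝ) : ℝ :=
  ((impulseResponse A B C t)ᵀ * impulseResponse A B C t).trace

/-- The `H₂`-norm of `ẋ = A x + B w`, `z = C x`: the `L²`-norm of the impulse response on `(0, ∞)`
(meaningful where the impulse response is square integrable). -/
noncomputable def h2Norm (A : Matrix (Fin n) (Fin n) ℝ) (B : Matrix (Fin n) (Fin m) ℝ)
    {ι : Type} [Fintype ι] (C : Matrix ι (Fin n) ℝ) : ℝ :=
  Real.sqrt (∫ t in Set.Ioi (0 : ℝ), impulseEnergy A B C t)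

/-- The feedback gain `K = R⁻¹ Bᵀ P`, `R = I`, of the linear-quadratic regulator `u = -K x` for the
cost `∫ (q² |C x|² + |u|²) dt`. -/
noncomputable def lqrGain (A : Matrix (Fin n) (Fin n) ℝ) (B : Matrix (Fin n) (Fin m) ℝ)
    (C : Matrix (Fin p) (Fin n) ℝ) (q : ℝ) : Matrix (Fin m) (Fin n) ℝ :=
  Bᵀ * riccatiSolution A B (q ^ 2 • (Cᵀ * C))

/-- State matrix of the closed loop under the linear-quadratic regulator. -/
noncomputable def lqrClosedLoop (A : Matrix (Fin n) (Fin n) ℝ) (B : Matrix (Fin n) (Fin m) ℝ)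
    (C : Matrix (Fin p) (Fin n) ℝ) (q : ℝ) : Matrix (Fin n) (Fin n) ℝ :=
  A - B * lqrGain A B C q

/-- Output matrix of the performance output `z = (q C x, u)` with `u = -K x`. -/
noncomputable def lqrOutput (A : Matrix (Fin n) (Fin n) ℝ) (B : Matrix (Fin n) (Fin m) ℝ)
    (C : Matrix (Fin p) (Fin n) ℝ) (q : ℝ) : Matrix (Fin p ⊕ Fin m) (Fin n) ℝ :=
  Matrix.fromRows (q • C) (-lqrGain A B C q)

end Control

namespace UAV

/-- `P` is a positive semidefinite solution of the Riccati equation of lateral subsystem `i`. -/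
def IsLatRiccati (S : UAV) (i : Fin 2) (zPOI zPL : ℝ) (P : Matrix (Fin 4) (Fin 4) ℝ) : Prop :=
  IsPSDRiccatiSolution (latA S.g i) (latB (S.alpha zPOI zPL) i)
    (S.qHat i zPL ^ 2 • (latCᵀ * latC)) P

/-- Energy at time `t` of the impulse response, from the input disturbance to the performance
output `(q̂_i y_i, u_i)`, of the optimally controlled lateral subsystem `i`. -/
noncomputable def latEnergy (S : UAV) (i : Fin 2) (zPOI zPL t : ℝ) : ℝ :=
  let A := latA S.g i
  let B := latB (S.alpha zPOI zPL) i
  let q := S.qHat i zPL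
  impulseEnergy (lqrClosedLoop A B latC q) B (lqrOutput A B latC q) t

/-- The `H₂`-norm, from the input disturbance to the performance output `(q̂_i y_i, u_i)`, of the
optimally controlled lateral subsystem `i`. -/
noncomputable def latH2 (S : UAV) (i : Fin 2) (zPOI zPL : ℝ) : ℝ :=
  let A := latA S.g i
  let B := latB (S.alpha zPOI zPL) i
  let q := S.qHat i zPL
  h2Norm (lqrClosedLoop A B latC q) B (lqrOutput A B latC q)

end UAV

/-!
Every positive semidefinite solution `P` of the Riccati equation of a detectable pair stabilizes:
it also solves the Lyapunov equation of its own closed loop, so along an eigenvector outside the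
open left half-plane the performance output would vanish, against detectability. The difference of
two solutions solves a homogeneous Sylvester equation between two Hurwitz closed loops, hence is
zero. Integrating the Lyapunov equation along the closed-loop flow gives `H₂² = tr (Bᵀ P B)`.

For a lateral subsystem this trace is minus the sum of the closed-loop poles, which are the stable
roots of `s⁸ + q̂² (α s² + g)²`. In the variables `s = ρ ν` with `ρ = (2 g q̂)^(1/4)`, and
`α = √(2 g / q̂) (1 - sinh u)`, this polynomial is a multiple of `ν⁸ + ((1 - sinh u) ν² + 1/2)²`,
whose stable factor is `ν⁴ + 2 c ν³ + 2 c² ν² + e^(u/2) ν + 1/2` with `c = cosh (u/2)`. Hence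
`H₂² = 2 ρ cosh (u/2)`, which is minimal exactly at `u = 0`, and `ρ` is minimal exactly at
`z_PL = 0`.
-/

section Spectral

variable {ι κ : Type*} [Fintype ι] [DecidableEq ι] [Fintype κ] [DecidableEq κ]

theorem aeval_mul_eq_mul_aeval {R : Type*} [CommRing R] {A : Matrix ι ι R} {B : Matrix κ κ R}
    {X : Matrix ι κ R} (h : A * X = X * B) (p : Polynomial R) :
    Polynomial.aeval A p * X = X * Polynomial.aeval B p := by
  induction p using Polynomial.induction_on with
  | C a => simp [Algebra.algebraMap_eq_smul_one]
  | add p q hp hq => simp only [map_add, Matrix.add_mul, Matrix.mul_add, hp, hq]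
  | monomial n a ih =>
    rw [pow_succ, ← mul_assoc, map_mul, map_mul _ _ Polynomial.X, Polynomial.aeval_X,
      Polynomial.aeval_X, Matrix.mul_assoc, h, ← Matrix.mul_assoc, ih, Matrix.mul_assoc]

theorem eq_zero_of_mul_eq_mul_of_disjoint_spectrum {K : Type*} [Field K] [IsAlgClosed K]
    {A : Matrix ι ι K} {B : Matrix κ κ K} {X : Matrix ι κ K}
    (hAB : Disjoint (spectrum K A) (spectrum K B)) (h : A * X = X * B) : X = 0 := by
  have hunit : IsUnit (Polynomial.aeval A B.charpoly) := by
    by_contra hA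
    rw [(IsAlgClosed.splits B.charpoly).eq_prod_roots_of_monic B.charpoly_monic] at hA
    obtain ⟨μ, hμA, hμB⟩ := spectrum.exists_mem_of_not_isUnit_aeval_prod hA
    exact hAB.notMem_of_mem_left hμA (Matrix.mem_spectrum_iff_isRoot_charpoly.2 hμB)
  have hzero : Polynomial.aeval A B.charpoly * X = 0 := by
    rw [aeval_mul_eq_mul_aeval h, Matrix.aeval_self_charpoly, Matrix.mul_zero]
  calc X = (Polynomial.aeval A B.charpoly)⁻¹ * (Polynomial.aeval A B.charpoly * X) :=
        (Matrix.nonsing_inv_mul_cancel_left _ _ ((Matrix.isUnit_iff_isUnit_det _).1 hunit)).symm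
    _ = 0 := by rw [hzero, Matrix.mul_zero]

/-- A real square matrix is Hurwitz if its complex eigenvalues lie in the open left half-plane;
this is the asymptotic stability of `ẋ = A x`. -/
def IsHurwitz (A : Matrix ι ι ℝ) : Prop :=
  ∀ μ ∈ spectrum ℂ (A.map Complex.ofRealHom), μ.re < 0

theorem isHurwitz_of_forall_mulVec {A : Matrix ι ι ℝ}
    (h : ∀ (μ : ℂ) (v : ι → ℂ), v ≠ 0 → A.map Complex.ofRealHom *ᵥ v = μ • v → μ.re < 0) :
    IsHurwitz A := by
  intro μ hμ
  rw [← Matrix.spectrum_toLin', ← Module.End.hasEigenvalue_iff_mem_spectrum] at hμ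
  obtain ⟨v, hv⟩ := hμ.exists_hasEigenvector
  exact h μ v hv.2 hv.apply_eq_smul

theorem IsHurwitz.transpose {A : Matrix ι ι ℝ} (hA : IsHurwitz A) : IsHurwitz Aᵀ := fun μ hμ =>
  hA μ <| by
    rwa [Matrix.mem_spectrum_iff_isRoot_charpoly, ← Matrix.charpoly_transpose,
      ← Matrix.transpose_map, ← Matrix.mem_spectrum_iff_isRoot_charpoly]

theorem IsHurwitz.eq_zero_of_mul_add_mul_eq_zero {A : Matrix ι ι ℝ} {B : Matrix κ κ ℝ}
    {X : Matrix ι κ ℝ} (hA : IsHurwitz A) (hB : IsHurwitz B) (h : A * X + X * B = 0) : X = 0 := by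
  have hAB : Disjoint (spectrum ℂ (A.map Complex.ofRealHom))
      (spectrum ℂ (-B.map Complex.ofRealHom)) := by
    refine Set.disjoint_left.2 fun μ hμA hμB => ?_
    rw [← spectrum.neg_eq, Set.mem_neg] at hμB
    have := hB _ hμB
    rw [Complex.neg_re] at this
    linarith [hA _ hμA]
  have hX : X.map Complex.ofRealHom = 0 := by
    refine eq_zero_of_mul_eq_mul_of_disjoint_spectrum hAB ?_
    rw [Matrix.mul_neg, ← Matrix.map_mul, eq_neg_of_add_eq_zero_left h,
      Matrix.map_neg _ (map_neg _), Matrix.map_mul]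
  ext j k
  simpa using congrFun (congrFun hX j) k

end Spectral

section Detectability

variable {ι κ ν : Type*}

open scoped ComplexOrder in
theorem posSemidef_map_ofReal [Finite ι] {P : Matrix ι ι ℝ} (hP : P.PosSemidef) :
    (P.map Complex.ofRealHom).PosSemidef := by
  cases nonempty_fintype ι
  obtain ⟨m, v, rfl⟩ := Matrix.posSemidef_iff_eq_sum_vecMulVec.1 hP
  refine Matrix.posSemidef_iff_eq_sum_vecMulVec.2 ⟨m, fun i => Complex.ofRealHom ∘ v i, ?_⟩
  ext j k
  simp [Matrix.sum_apply, Matrix.vecMulVec_apply]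

theorem transpose_map_ofReal (M : Matrix κ ι ℝ) :
    Mᵀ.map Complex.ofRealHom = (M.map Complex.ofRealHom)ᴴ := by
  ext
  simp

variable [Fintype ι]

/-- Detectability of the pair `(A, C)`, in the form of the Popov–Belevitch–Hautus test: the output
matrix `C` does not vanish on any eigenvector of `A` outside the open left half-plane. -/
def IsDetectable (A : Matrix ι ι ℝ) (C : Matrix κ ι ℝ) : Prop :=
  ∀ (μ : ℂ) (v : ι → ℂ), 0 ≤ μ.re → A.map Complex.ofRealHom *ᵥ v = μ • v →
    C.map Complex.ofRealHom *ᵥ v = 0 → v = 0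

theorem IsDetectable.sub_mul [Fintype ν] {A : Matrix ι ι ℝ} {C : Matrix κ ι ℝ}
    (h : IsDetectable A C) {q : ℝ} (hq : q ≠ 0) (B : Matrix ι ν ℝ) (K : Matrix ν ι ℝ) :
    IsDetectable (A - B * K) (fromRows (q • C) (-K)) := by
  intro μ v hμ hAv hEv
  have hCv : C.map Complex.ofRealHom *ᵥ v = 0 := by
    ext j
    have := congrFun hEv (Sum.inl j)
    simp only [Matrix.mulVec, dotProduct, Matrix.map_apply, fromRows_apply_inl, Matrix.smul_apply,
      smul_eq_mul, map_mul, mul_assoc, ← Finset.mul_sum, Pi.zero_apply, mul_eq_zero] at this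
    exact this.resolve_left (by simpa using hq)
  have hKv : K.map Complex.ofRealHom *ᵥ v = 0 := by
    ext j
    simpa [Matrix.mulVec, dotProduct] using congrFun hEv (Sum.inr j)
  refine h μ v hμ ?_ hCv
  rw [← hAv, Matrix.map_sub _ (map_sub _), Matrix.sub_mulVec, Matrix.map_mul,
    ← Matrix.mulVec_mulVec, hKv, Matrix.mulVec_zero, sub_zero]

open scoped ComplexOrder in
theorem isHurwitz_of_lyapunov [DecidableEq ι] [Fintype κ] {A P : Matrix ι ι ℝ} {C : Matrix κ ι ℝ}
    (hP : P.PosSemidef) (h : Aᵀ * P + P * A + Cᵀ * C = 0) (hAC : IsDetectable A C) :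
    IsHurwitz A := by
  refine isHurwitz_of_forall_mulVec fun μ v hv hAv => ?_
  by_contra! hμ
  set a := A.map Complex.ofRealHom
  set p := P.map Complex.ofRealHom
  set c := C.map Complex.ofRealHom
  have hpv : 0 ≤ star v ⬝ᵥ p *ᵥ v := (posSemidef_map_ofReal hP).dotProduct_mulVec_nonneg v
  have hadj : aᴴ * p + p * a + cᴴ * c = 0 := by
    simpa only [Matrix.map_add _ (map_add _), Matrix.map_mul, Matrix.map_zero _ (map_zero _),
      transpose_map_ofReal] using congrArg (fun M => M.map Complex.ofRealHom) h
  have hre : star μ + μ = (2 * μ.re : ℝ) := (add_comm _ _).trans (Complex.add_conj μ)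
  have henergy : (2 * μ.re : ℝ) * (star v ⬝ᵥ p *ᵥ v) + star (c *ᵥ v) ⬝ᵥ c *ᵥ v = 0 := by
    have := congrArg (fun M => star v ⬝ᵥ M *ᵥ v) hadj
    simp only [Matrix.add_mulVec, dotProduct_add, ← Matrix.mulVec_mulVec, hAv,
      Matrix.dotProduct_mulVec _ aᴴ, Matrix.dotProduct_mulVec _ cᴴ, ← Matrix.star_mulVec,
      Matrix.mulVec_smul, star_smul, smul_dotProduct, dotProduct_smul, smul_eq_mul,
      Matrix.zero_mulVec, dotProduct_zero] at this
    rwa [← add_mul, hre] at this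
  have hcv : c *ᵥ v = 0 := by
    have hμ' : (0 : ℂ) ≤ (2 * μ.re : ℝ) := Complex.zero_le_real.2 (by positivity)
    exact dotProduct_star_self_eq_zero.1
      ((add_eq_zero_iff_of_nonneg (mul_nonneg hμ' hpv) (dotProduct_star_self_nonneg _)).1 henergy).2
  exact hv (hAC μ v hμ hAv hcv)

end Detectability

section LyapunovFlow

open Filter Topology
open scoped Matrix.Norms.Operator MatrixOrder

variable {ι : Type*}

theorem dotProduct_mulVec_polarization [Fintype ι] [DecidableEq ι] {M : Matrix ι ι ℝ}
    (hM : M.IsHermitian) (j k : ι) :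
    M j k = ((Pi.single j 1 + Pi.single k 1) ⬝ᵥ M *ᵥ (Pi.single j 1 + Pi.single k 1) -
      (Pi.single j 1 - Pi.single k 1) ⬝ᵥ M *ᵥ (Pi.single j 1 - Pi.single k 1)) / 4 := by
  have hkj : M k j = M j k := hM.apply j k
  simp only [Matrix.mulVec_add, Matrix.mulVec_sub, add_dotProduct, sub_dotProduct,
    dotProduct_add, dotProduct_sub, single_one_dotProduct, Matrix.mulVec_single_one,
    Matrix.col_apply, hkj]
  ring

theorem exists_tendsto_atTop_of_antitone [Finite ι] {F : ℝ → Matrix ι ι ℝ}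
    (hF : Antitone F) (hnn : ∀ t, 0 ≤ F t) : ∃ X, Tendsto F atTop (𝓝 X) := by
  classical
  cases nonempty_fintype ι
  have hform (v : ι → ℝ) : ∃ c, Tendsto (fun t => v ⬝ᵥ F t *ᵥ v) atTop (𝓝 c) := by
    refine ⟨_, tendsto_atTop_ciInf (fun s t hst => ?_) ⟨0, ?_⟩⟩
    · have := (Matrix.le_iff.1 (hF hst)).dotProduct_mulVec_nonneg v
      simpa [Matrix.sub_mulVec, dotProduct_sub] using this
    · rintro _ ⟨t, rfl⟩
      simpa using (Matrix.nonneg_iff_posSemidef.1 (hnn t)).dotProduct_mulVec_nonneg v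
  have hentry (j k : ι) : ∃ c, Tendsto (fun t => F t j k) atTop (𝓝 c) := by
    obtain ⟨c, hc⟩ := hform (Pi.single j 1 + Pi.single k 1)
    obtain ⟨d, hd⟩ := hform (Pi.single j 1 - Pi.single k 1)
    exact ⟨(c - d) / 4, ((hc.sub hd).div_const 4).congr fun t =>
      (dotProduct_mulVec_polarization (Matrix.nonneg_iff_posSemidef.1 (hnn t)).1 j k).symm⟩
  choose X hX using hentry
  exact ⟨Matrix.of X, tendsto_pi_nhds.2 fun j => tendsto_pi_nhds.2 fun k => hX j k⟩

variable [Fintype ι] [DecidableEq ι]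

/-- The flow `t ↦ exp(t Aᵀ) P exp(t A)` of the Lyapunov operator `P ↦ Aᵀ P + P A`. Its quadratic
form at `x` is the value of that of `P` along the trajectory of `ẋ = A x` starting at `x`. -/
noncomputable def lyapunovFlow (A P : Matrix ι ι ℝ) (t : ℝ) : Matrix ι ι ℝ :=
  NormedSpace.exp (t • Aᵀ) * P * NormedSpace.exp (t • A)

variable {A P Q : Matrix ι ι ℝ}

theorem lyapunovFlow_zero (A P : Matrix ι ι ℝ) : lyapunovFlow A P 0 = P := by
  simp [lyapunovFlow]

theorem lyapunovFlow_add (A P : Matrix ι ι ℝ) (s t : ℝ) :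
    lyapunovFlow A P (t + s) = lyapunovFlow A (lyapunovFlow A P t) s := by
  have hexp (M : Matrix ι ι ℝ) (s t : ℝ) : NormedSpace.exp ((t + s) • M) =
      NormedSpace.exp (t • M) * NormedSpace.exp (s • M) := by
    rw [add_smul]
    exact Matrix.exp_add_of_commute _ _ (((Commute.refl M).smul_left t).smul_right s)
  simp only [lyapunovFlow, hexp A s t, add_comm t s ▸ hexp Aᵀ t s, Matrix.mul_assoc]

theorem hasDerivAt_lyapunovFlow (A P : Matrix ι ι ℝ) (t : ℝ) :
    HasDerivAt (lyapunovFlow A P) (lyapunovFlow A (Aᵀ * P + P * A) t) t := by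
  refine (((hasDerivAt_exp_smul_const (𝕂 := ℝ) Aᵀ t).mul_const P).mul
    (hasDerivAt_exp_smul_const' (𝕂 := ℝ) A t)).congr_deriv ?_
  simp only [lyapunovFlow]
  noncomm_ring

theorem hasDerivAt_lyapunovFlow_of_lyapunov (h : Aᵀ * P + P * A + Q = 0) (t : ℝ) :
    HasDerivAt (lyapunovFlow A P) (-lyapunovFlow A Q t) t := by
  refine (hasDerivAt_lyapunovFlow A P t).congr_deriv ?_
  simp only [eq_neg_of_add_eq_zero_left h, lyapunovFlow, Matrix.mul_neg, Matrix.neg_mul]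

theorem lyapunovFlow_nonneg (hP : P.PosSemidef) (t : ℝ) : 0 ≤ lyapunovFlow A P t := by
  rw [Matrix.nonneg_iff_posSemidef, lyapunovFlow, ← Matrix.transpose_smul, Matrix.exp_transpose,
    ← Matrix.conjTranspose_eq_transpose_of_trivial]
  exact hP.conjTranspose_mul_mul_same _

theorem hasDerivAt_trace_lyapunovFlow_mul (h : Aᵀ * P + P * A + Q = 0) (N : Matrix ι ι ℝ) (t : ℝ) :
    HasDerivAt (fun t => (lyapunovFlow A P t * N).trace) (-(lyapunovFlow A Q t * N).trace) t := by
  refine ((Matrix.traceLinearMap ι ℝ ℝ).toContinuousLinearMap.hasFDerivAt.comp_hasDerivAt t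
    ((hasDerivAt_lyapunovFlow_of_lyapunov h t).mul_const N)).congr_deriv ?_
  rw [Matrix.neg_mul]
  exact Matrix.trace_neg _

theorem antitone_lyapunovFlow (hP : P.PosSemidef) (hQ : Q.PosSemidef)
    (h : Aᵀ * P + P * A + Q = 0) : Antitone (lyapunovFlow A P) := by
  have hherm (t : ℝ) : (lyapunovFlow A P t).IsHermitian :=
    (Matrix.nonneg_iff_posSemidef.1 (lyapunovFlow_nonneg hP t)).1
  have hform (v : ι → ℝ) : Antitone fun t => v ⬝ᵥ lyapunovFlow A P t *ᵥ v := by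
    refine antitone_of_hasDerivAt_nonpos (f' := fun t => -(v ⬝ᵥ lyapunovFlow A Q t *ᵥ v))
      (fun t => ?_) fun t => ?_
    · simpa only [Matrix.mul_vecMulVec, Matrix.trace_vecMulVec, dotProduct_comm _ v] using
        hasDerivAt_trace_lyapunovFlow_mul h (Matrix.vecMulVec v v) t
    · simpa using (Matrix.nonneg_iff_posSemidef.1
        (lyapunovFlow_nonneg hQ t)).dotProduct_mulVec_nonneg v
  intro s t hst
  rw [Matrix.le_iff]
  refine .of_dotProduct_mulVec_nonneg ((hherm s).sub (hherm t)) fun v => ?_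
  simpa [Matrix.sub_mulVec, dotProduct_sub] using hform v hst

theorem tendsto_lyapunovFlow_atTop (hA : IsHurwitz A) (hP : P.PosSemidef) (hQ : Q.PosSemidef)
    (h : Aᵀ * P + P * A + Q = 0) : Tendsto (lyapunovFlow A P) atTop (𝓝 0) := by
  obtain ⟨X, hX⟩ := exists_tendsto_atTop_of_antitone (antitone_lyapunovFlow hP hQ h)
    (lyapunovFlow_nonneg hP)
  have hfixed (s : ℝ) : lyapunovFlow A X s = X := by
    have hshift : Tendsto (fun t => lyapunovFlow A P (t + s)) atTop (𝓝 X) :=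
      hX.comp (tendsto_atTop_add_const_right _ s tendsto_id)
    simp only [lyapunovFlow_add] at hshift
    exact tendsto_nhds_unique ((tendsto_const_nhds.mul hX).mul tendsto_const_nhds) hshift
  have hlyap : Aᵀ * X + X * A = 0 := by
    have hderiv := hasDerivAt_lyapunovFlow A X 0
    rw [lyapunovFlow_zero, funext hfixed] at hderiv
    exact hderiv.unique (hasDerivAt_const 0 X)
  rwa [hA.transpose.eq_zero_of_mul_add_mul_eq_zero hA hlyap] at hX

end LyapunovFlow

section H2Norm

open Filter Topology
open scoped Matrix.Norms.Operator MatrixOrder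

variable {n m : ℕ} {ι : Type} [Fintype ι] {A P : Matrix (Fin n) (Fin n) ℝ}
  {B : Matrix (Fin n) (Fin m) ℝ} {C : Matrix ι (Fin n) ℝ}

theorem impulseEnergy_eq_trace (A : Matrix (Fin n) (Fin n) ℝ) (B : Matrix (Fin n) (Fin m) ℝ)
    (C : Matrix ι (Fin n) ℝ) (t : ℝ) :
    impulseEnergy A B C t = (Bᵀ * lyapunovFlow A (Cᵀ * C) t * B).trace := by
  simp only [impulseEnergy, impulseResponse, lyapunovFlow, ← Matrix.transpose_smul,
    Matrix.exp_transpose, Matrix.transpose_mul, Matrix.mul_assoc]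

theorem impulseEnergy_nonneg (A : Matrix (Fin n) (Fin n) ℝ) (B : Matrix (Fin n) (Fin m) ℝ)
    (C : Matrix ι (Fin n) ℝ) (t : ℝ) : 0 ≤ impulseEnergy A B C t := by
  rw [impulseEnergy, ← Matrix.conjTranspose_eq_transpose_of_trivial]
  exact (Matrix.posSemidef_conjTranspose_mul_self _).trace_nonneg

theorem hasDerivAt_neg_trace_lyapunovFlow (h : Aᵀ * P + P * A + Cᵀ * C = 0)
    (B : Matrix (Fin n) (Fin m) ℝ) (t : ℝ) :
    HasDerivAt (fun t => -(Bᵀ * lyapunovFlow A P t * B).trace) (impulseEnergy A B C t) t := by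
  simpa only [impulseEnergy_eq_trace, Matrix.mul_assoc, Matrix.trace_mul_comm Bᵀ, neg_neg] using
    (hasDerivAt_trace_lyapunovFlow_mul h (B * Bᵀ) t).fun_neg

theorem tendsto_neg_trace_lyapunovFlow (hA : IsHurwitz A) (hP : P.PosSemidef)
    (h : Aᵀ * P + P * A + Cᵀ * C = 0) (B : Matrix (Fin n) (Fin m) ℝ) :
    Tendsto (fun t => -(Bᵀ * lyapunovFlow A P t * B).trace) atTop (𝓝 0) := by
  have hC : (Cᵀ * C).PosSemidef := by
    rw [← Matrix.conjTranspose_eq_transpose_of_trivial]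
    exact Matrix.posSemidef_conjTranspose_mul_self C
  have hcont : Continuous fun M : Matrix (Fin n) (Fin n) ℝ => -(Bᵀ * M * B).trace := by fun_prop
  simpa [Function.comp_def] using (hcont.tendsto 0).comp (tendsto_lyapunovFlow_atTop hA hP hC h)

theorem integrableOn_impulseEnergy (hA : IsHurwitz A) (hP : P.PosSemidef)
    (h : Aᵀ * P + P * A + Cᵀ * C = 0) (B : Matrix (Fin n) (Fin m) ℝ) :
    IntegrableOn (impulseEnergy A B C) (Set.Ioi 0) :=
  integrableOn_Ioi_deriv_of_nonneg' (fun t _ => hasDerivAt_neg_trace_lyapunovFlow h B t)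
    (fun t _ => impulseEnergy_nonneg A B C t) (tendsto_neg_trace_lyapunovFlow hA hP h B)

theorem h2Norm_eq_sqrt_trace (hA : IsHurwitz A) (hP : P.PosSemidef)
    (h : Aᵀ * P + P * A + Cᵀ * C = 0) (B : Matrix (Fin n) (Fin m) ℝ) :
    h2Norm A B C = √(Bᵀ * P * B).trace := by
  rw [h2Norm, integral_Ioi_of_hasDerivAt_of_nonneg'
    (fun t _ => hasDerivAt_neg_trace_lyapunovFlow h B t)
    (fun t _ => impulseEnergy_nonneg A B C t) (tendsto_neg_trace_lyapunovFlow hA hP h B),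
    lyapunovFlow_zero, zero_sub, neg_neg]

end H2Norm

section LinearQuadraticRegulator

variable {n m p : ℕ} {A P P' : Matrix (Fin n) (Fin n) ℝ} {B : Matrix (Fin n) (Fin m) ℝ}
  {C : Matrix (Fin p) (Fin n) ℝ} {q : ℝ}

namespace IsPSDRiccatiSolution

theorem transpose_eq {Q : Matrix (Fin n) (Fin n) ℝ} (hP : IsPSDRiccatiSolution A B Q P) : Pᵀ = P :=
  (Matrix.conjTranspose_eq_transpose_of_trivial P).symm.trans hP.1.1

theorem closedLoop_lyapunov (hP : IsPSDRiccatiSolution A B (q ^ 2 • (Cᵀ * C)) P) :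
    (A - B * (Bᵀ * P))ᵀ * P + P * (A - B * (Bᵀ * P)) +
      (fromRows (q • C) (-(Bᵀ * P)))ᵀ * fromRows (q • C) (-(Bᵀ * P)) = 0 := by
  rw [← hP.2, Matrix.transpose_fromRows, Matrix.fromCols_mul_fromRows]
  simp only [Matrix.transpose_sub, Matrix.transpose_mul, Matrix.transpose_transpose,
    Matrix.transpose_neg, Matrix.transpose_smul, hP.transpose_eq, Matrix.sub_mul, Matrix.mul_sub,
    Matrix.neg_mul, Matrix.mul_neg, neg_neg, Matrix.smul_mul, Matrix.mul_smul, smul_smul, pow_two,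
    Matrix.mul_assoc]
  abel

theorem isHurwitz_closedLoop (hP : IsPSDRiccatiSolution A B (q ^ 2 • (Cᵀ * C)) P)
    (hAC : IsDetectable A C) (hq : q ≠ 0) : IsHurwitz (A - B * (Bᵀ * P)) :=
  isHurwitz_of_lyapunov hP.1 hP.closedLoop_lyapunov (hAC.sub_mul hq B (Bᵀ * P))

theorem eq (hP : IsPSDRiccatiSolution A B (q ^ 2 • (Cᵀ * C)) P)
    (hP' : IsPSDRiccatiSolution A B (q ^ 2 • (Cᵀ * C)) P') (hAC : IsDetectable A C) (hq : q ≠ 0) :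
    P = P' := by
  have hsylvester : (A - B * (Bᵀ * P))ᵀ * (P - P') + (P - P') * (A - B * (Bᵀ * P')) = 0 := by
    rw [← sub_eq_zero.2 (hP.2.trans hP'.2.symm)]
    simp only [Matrix.transpose_sub, Matrix.transpose_mul, Matrix.transpose_transpose,
      hP.transpose_eq, Matrix.sub_mul, Matrix.mul_sub, Matrix.mul_assoc]
    abel
  exact sub_eq_zero.1 ((hP.isHurwitz_closedLoop hAC hq).transpose.eq_zero_of_mul_add_mul_eq_zero
    (hP'.isHurwitz_closedLoop hAC hq) hsylvester)

theorem lqrGain_eq (hP : IsPSDRiccatiSolution A B (q ^ 2 • (Cᵀ * C)) P) (hAC : IsDetectable A C)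
    (hq : q ≠ 0) : lqrGain A B C q = Bᵀ * P := by
  rw [lqrGain, riccatiSolution, IsPSDRiccatiSolution.eq (Classical.epsilon_spec ⟨P, hP⟩) hP hAC hq]

theorem integrableOn_impulseEnergy_lqr (hP : IsPSDRiccatiSolution A B (q ^ 2 • (Cᵀ * C)) P)
    (hAC : IsDetectable A C) (hq : q ≠ 0) :
    IntegrableOn (impulseEnergy (lqrClosedLoop A B C q) B (lqrOutput A B C q)) (Set.Ioi 0) := by
  rw [lqrClosedLoop, lqrOutput, hP.lqrGain_eq hAC hq]
  exact integrableOn_impulseEnergy (hP.isHurwitz_closedLoop hAC hq) hP.1 hP.closedLoop_lyapunov B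

theorem h2Norm_lqr (hP : IsPSDRiccatiSolution A B (q ^ 2 • (Cᵀ * C)) P) (hAC : IsDetectable A C)
    (hq : q ≠ 0) :
    h2Norm (lqrClosedLoop A B C q) B (lqrOutput A B C q) = √(Bᵀ * P * B).trace := by
  rw [lqrClosedLoop, lqrOutput, hP.lqrGain_eq hAC hq]
  exact h2Norm_eq_sqrt_trace (hP.isHurwitz_closedLoop hAC hq) hP.1 hP.closedLoop_lyapunov B

end IsPSDRiccatiSolution

end LinearQuadraticRegulator

namespace UAV

section LateralRiccati

/-- The sign by which `g` and `α` enter lateral subsystem `i`: up to it, the two subsystems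
coincide. -/
def latSign (i : Fin 2) : ℝ := ![1, -1] i

theorem latSign_ne_zero (i : Fin 2) : latSign i ≠ 0 := by
  fin_cases i <;> norm_num [latSign]

theorem latSign_sq (i : Fin 2) : latSign i ^ 2 = 1 := by
  fin_cases i <;> norm_num [latSign]

theorem latA_eq_latA_zero (g : ℝ) (i : Fin 2) : latA g i = latA (latSign i * g) 0 := by
  fin_cases i <;> simp [latSign, latA_zero, latA_one]

theorem latB_eq_latB_zero (α : ℝ) (i : Fin 2) : latB α i = latB (latSign i * α) 0 := by
  fin_cases i <;> simp [latSign, latB_zero, latB_one]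

theorem isDetectable_latA {g : ℝ} (hg : g ≠ 0) (i : Fin 2) : IsDetectable (latA g i) latC := by
  intro μ v _ hAv hCv
  rw [latA_eq_latA_zero, latA_zero] at hAv
  have hv₀ : v 0 = 0 := by
    simpa [latC, Matrix.mulVec, dotProduct, Fin.sum_univ_four] using congrFun hCv 0
  have hv₁ : v 1 = 0 := by
    simpa [Matrix.mulVec, dotProduct, Fin.sum_univ_four, hv₀] using congrFun hAv 0
  have hv₂ : v 2 = 0 := by
    simpa [Matrix.mulVec, dotProduct, Fin.sum_univ_four, hv₁, hg, latSign_ne_zero] using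
      congrFun hAv 1
  have hv₃ : v 3 = 0 := by
    simpa [Matrix.mulVec, dotProduct, Fin.sum_univ_four, hv₂] using congrFun hAv 2
  ext j
  fin_cases j <;> assumption

/-- The positive semidefinite Riccati solution of lateral subsystem 1 with weight `q` when
`g = ρ⁴ / (2 q)` and `α = (1 - (τ² - τ⁻²) / 2) ρ² / q`, in factored form. It is also that of
subsystem 2, with `q` negative. -/
noncomputable def latRiccati (q ρ τ : ℝ) : Matrix (Fin 4) (Fin 4) ℝ :=
  let U := !![q, q * τ / ρ, ρ ^ 2 * (τ ^ 2 - 1) / 2, ρ * τ * (τ ^ 2 - 2) / 2;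
              0, q, ρ ^ 3 * τ / 2, ρ ^ 2 * (τ ^ 4 - τ ^ 2 - 1) / (2 * τ ^ 2);
              0, 0, ρ, τ;
              0, 0, 0, 1]
  Uᵀ * diagonal ![2 * τ / ρ, 2 * τ / ρ ^ 3, ρ / (2 * τ), ρ / (2 * τ)] * U

variable {q ρ τ : ℝ}

theorem posSemidef_latRiccati (q : ℝ) (hρ : 0 < ρ) (hτ : 0 < τ) :
    (latRiccati q ρ τ).PosSemidef := by
  rw [latRiccati, ← Matrix.conjTranspose_eq_transpose_of_trivial]
  refine (Matrix.PosSemidef.diagonal fun j => ?_).conjTranspose_mul_mul_same _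
  fin_cases j <;>
    simp only [Fin.isValue, Fin.zero_eta, Fin.mk_one, Fin.reduceFinMk, Pi.zero_apply, cons_val] <;>
    positivity

theorem latB_transpose_mul_latRiccati (hq : q ≠ 0) (hρ : ρ ≠ 0) (hτ : τ ≠ 0) :
    (latB ((1 - (τ ^ 2 - (τ ^ 2)⁻¹) / 2) * (ρ ^ 2 / q)) 0)ᵀ * latRiccati q ρ τ =
      !![q, 2 * q * τ / ρ, ρ ^ 2 * τ ^ 2, ρ * τ * (τ ^ 2 - 1)] := by
  rw [latB_zero]
  ext j k
  fin_cases j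
  fin_cases k <;>
    simp [latRiccati, Matrix.mul_apply, Fin.sum_univ_four, Matrix.diagonal_apply] <;>
    field_simp <;> ring

theorem latRiccati_equation (hq : q ≠ 0) (hρ : ρ ≠ 0) (hτ : τ ≠ 0) :
    let A := latA (ρ ^ 4 / (2 * q)) 0
    let K := !![q, 2 * q * τ / ρ, ρ ^ 2 * τ ^ 2, ρ * τ * (τ ^ 2 - 1)]
    Aᵀ * latRiccati q ρ τ + latRiccati q ρ τ * A - Kᵀ * K + q ^ 2 • (latCᵀ * latC) = 0 := by
  rw [latA_zero]
  ext j k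
  fin_cases j <;> fin_cases k <;>
    simp [latRiccati, latC, Matrix.mul_apply, Fin.sum_univ_four, Matrix.diagonal_apply] <;>
    field_simp <;> ring

theorem isPSDRiccatiSolution_latRiccati (hq : q ≠ 0) (hρ : 0 < ρ) (hτ : 0 < τ) :
    IsPSDRiccatiSolution (latA (ρ ^ 4 / (2 * q)) 0)
      (latB ((1 - (τ ^ 2 - (τ ^ 2)⁻¹) / 2) * (ρ ^ 2 / q)) 0) (q ^ 2 • (latCᵀ * latC))
      (latRiccati q ρ τ) := by
  have hP := posSemidef_latRiccati q hρ hτ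
  have hsymm : (latRiccati q ρ τ)ᵀ = latRiccati q ρ τ := hP.1
  refine ⟨hP, ?_⟩
  rw [← latRiccati_equation hq hρ.ne' hτ.ne', ← latB_transpose_mul_latRiccati hq hρ.ne' hτ.ne',
    Matrix.transpose_mul, Matrix.transpose_transpose, hsymm]
  simp only [Matrix.mul_assoc]

theorem trace_latRiccati (hq : q ≠ 0) (hρ : ρ ≠ 0) (hτ : τ ≠ 0) :
    let B := latB ((1 - (τ ^ 2 - (τ ^ 2)⁻¹) / 2) * (ρ ^ 2 / q)) 0
    (Bᵀ * latRiccati q ρ τ * B).trace = ρ * (τ + τ⁻¹) := by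
  intro B
  rw [latB_transpose_mul_latRiccati hq hρ hτ]
  simp only [B, latB_zero, Matrix.trace_fin_one, Matrix.mul_apply, Fin.sum_univ_four,
    Matrix.of_apply, Matrix.cons_val, Matrix.cons_val_fin_one]
  field_simp
  ring

end LateralRiccati

section LateralH2

/-- The rate `ρ = (2 g q̂)^(1/4)` that sets the time scale of the optimally controlled lateral
subsystem `i`. -/
noncomputable def latRate (S : UAV) (i : Fin 2) (zPL : ℝ) : ℝ :=
  (2 * S.g * S.qHat i zPL) ^ (1 / 4 : ℝ)

/-- The parameter `u` measuring the deviation of `α` from `α* = √(2 g / q̂)` on the hyperbolic scale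
`α = α* (1 - sinh u)`. -/
noncomputable def latShift (S : UAV) (i : Fin 2) (zPOI zPL : ℝ) : ℝ :=
  Real.arsinh (1 - S.alpha zPOI zPL / √(2 * S.g / S.qHat i zPL))

variable {S : UAV} {i : Fin 2} {zPOI zPL : ℝ}

theorem latRate_pos (hg : 0 < S.g) (hq : 0 < S.qHat i zPL) : 0 < S.latRate i zPL :=
  Real.rpow_pos_of_pos (by positivity) _

theorem latRate_pow_four (hg : 0 < S.g) (hq : 0 < S.qHat i zPL) :
    S.latRate i zPL ^ 4 = 2 * S.g * S.qHat i zPL := by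
  rw [latRate, ← Real.rpow_natCast, ← Real.rpow_mul (by positivity)]
  norm_num

theorem latRate_sq_div_qHat (hg : 0 < S.g) (hq : 0 < S.qHat i zPL) :
    S.latRate i zPL ^ 2 / S.qHat i zPL = √(2 * S.g / S.qHat i zPL) := by
  rw [eq_comm, Real.sqrt_eq_iff_mul_self_eq (by positivity) (by positivity)]
  field_simp
  rw [latRate_pow_four hg hq]

theorem alpha_eq (hg : 0 < S.g) (hq : 0 < S.qHat i zPL) :
    S.alpha zPOI zPL =
      (1 - Real.sinh (S.latShift i zPOI zPL)) * (S.latRate i zPL ^ 2 / S.qHat i zPL) := by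
  have hα : √(2 * S.g / S.qHat i zPL) ≠ 0 := by positivity
  rw [latShift, Real.sinh_arsinh, latRate_sq_div_qHat hg hq, sub_sub_cancel, div_mul_cancel₀ _ hα]

theorem latShift_eq_zero_iff (hg : 0 < S.g) (hq : 0 < S.qHat i zPL) :
    S.latShift i zPOI zPL = 0 ↔ S.alpha zPOI zPL = √(2 * S.g / S.qHat i zPL) := by
  rw [latShift, Real.arsinh_eq_zero_iff, sub_eq_zero, eq_comm, div_eq_one_iff_eq (by positivity)]

theorem latA_eq (hg : 0 < S.g) (hq : 0 < S.qHat i zPL) :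
    latA S.g i = latA (S.latRate i zPL ^ 4 / (2 * (latSign i * S.qHat i zPL))) 0 := by
  have hs := latSign_ne_zero i
  rw [latA_eq_latA_zero, latRate_pow_four hg hq]
  congr 1
  field_simp
  rw [latSign_sq]

theorem latB_alpha_eq (hg : 0 < S.g) (hq : 0 < S.qHat i zPL) :
    let τ := Real.exp (S.latShift i zPOI zPL / 2)
    latB (S.alpha zPOI zPL) i = latB ((1 - (τ ^ 2 - (τ ^ 2)⁻¹) / 2) *
      (S.latRate i zPL ^ 2 / (latSign i * S.qHat i zPL))) 0 := by
  intro τ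
  have hs := latSign_ne_zero i
  have hsinh : (τ ^ 2 - (τ ^ 2)⁻¹) / 2 = Real.sinh (S.latShift i zPOI zPL) := by
    rw [← Real.exp_nat_mul, ← Real.exp_neg, Real.sinh_eq]
    norm_num [mul_div_cancel₀]
  rw [latB_eq_latB_zero, alpha_eq hg hq, hsinh]
  congr 1
  field_simp
  rw [latSign_sq, one_mul]

theorem isLatRiccati_latRiccati (hg : 0 < S.g) (hq : 0 < S.qHat i zPL) :
    S.IsLatRiccati i zPOI zPL (latRiccati (latSign i * S.qHat i zPL) (S.latRate i zPL)
      (Real.exp (S.latShift i zPOI zPL / 2))) := by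
  have h := isPSDRiccatiSolution_latRiccati (mul_ne_zero (latSign_ne_zero i) hq.ne')
    (latRate_pos hg hq) (Real.exp_pos (S.latShift i zPOI zPL / 2))
  rwa [← latA_eq hg hq, ← latB_alpha_eq hg hq, mul_pow, latSign_sq, one_mul] at h

theorem existsUnique_isLatRiccati (hg : 0 < S.g) (hq : 0 < S.qHat i zPL) :
    ∃! P, S.IsLatRiccati i zPOI zPL P :=
  ⟨_, isLatRiccati_latRiccati hg hq, fun _ hP =>
    hP.eq (isLatRiccati_latRiccati hg hq) (isDetectable_latA hg.ne' i) hq.ne'⟩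

theorem integrableOn_latEnergy (hg : 0 < S.g) (hq : 0 < S.qHat i zPL) :
    IntegrableOn (S.latEnergy i zPOI zPL) (Set.Ioi 0) :=
  (isLatRiccati_latRiccati hg hq).integrableOn_impulseEnergy_lqr (isDetectable_latA hg.ne' i) hq.ne'

theorem latH2_eq (hg : 0 < S.g) (hq : 0 < S.qHat i zPL) :
    S.latH2 i zPOI zPL = √(2 * S.latRate i zPL * Real.cosh (S.latShift i zPOI zPL / 2)) := by
  rw [latH2, (isLatRiccati_latRiccati hg hq).h2Norm_lqr (isDetectable_latA hg.ne' i) hq.ne',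
    latB_alpha_eq hg hq, trace_latRiccati (mul_ne_zero (latSign_ne_zero i) hq.ne')
      (latRate_pos hg hq).ne' (Real.exp_pos _).ne', ← Real.exp_neg, Real.cosh_eq]
  congr 1
  ring

theorem latH2_eq_iff (hg : 0 < S.g) (hq : 0 < S.qHat i zPL) :
    S.latH2 i zPOI zPL = √(2 * S.latRate i zPL) ↔
      S.alpha zPOI zPL = √(2 * S.g / S.qHat i zPL) := by
  have hρ := latRate_pos hg hq
  have hcosh : Real.cosh (S.latShift i zPOI zPL / 2) = 1 ↔ S.latShift i zPOI zPL = 0 := by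
    rw [← not_iff_not, ← ne_eq, ← (Real.one_le_cosh _).lt_iff_ne', Real.one_lt_cosh,
      div_ne_zero_iff, and_iff_left two_ne_zero]
  rw [latH2_eq hg hq, Real.sqrt_inj (by positivity) (by positivity), mul_eq_left₀ (by positivity),
    hcosh, latShift_eq_zero_iff hg hq]

theorem sqrt_two_mul_latRate_le_latH2 (hg : 0 < S.g) (hq : 0 < S.qHat i zPL) :
    √(2 * S.latRate i zPL) ≤ S.latH2 i zPOI zPL := by
  have hρ := latRate_pos hg hq
  rw [latH2_eq hg hq]
  exact Real.sqrt_le_sqrt (le_mul_of_one_le_right (by positivity) (Real.one_le_cosh _))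

theorem qHat_pos (hmUAV : 0 < S.mUAV) (hmPL : 0 < S.mPL) (hHxx : 0 < S.Hxx) (hHyy : 0 < S.Hyy)
    (hq : 0 < S.q i) (zPL : ℝ) : 0 < S.qHat i zPL := by
  have hinertia : 0 < S.inertia i := by fin_cases i <;> simpa [inertia]
  unfold qHat b mTot
  positivity

theorem qHat_zero_lt_qHat (hmUAV : 0 < S.mUAV) (hmPL : 0 < S.mPL) (hq : 0 < S.q i) (hz : zPL ≠ 0) :
    S.qHat i 0 < S.qHat i zPL := by
  have hmTot : 0 < S.mTot := add_pos hmUAV hmPL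
  have hb : S.b i 0 < S.b i zPL := by
    have : 0 < S.mPL * S.mUAV * zPL ^ 2 := by positivity
    simpa [b] using this
  unfold qHat
  gcongr

theorem latRate_zero_lt_latRate (hg : 0 < S.g) (hmUAV : 0 < S.mUAV) (hmPL : 0 < S.mPL)
    (hq : 0 < S.q i) (hq₀ : 0 < S.qHat i 0) (hz : zPL ≠ 0) :
    S.latRate i 0 < S.latRate i zPL := by
  have hlt := qHat_zero_lt_qHat hmUAV hmPL hq hz
  unfold latRate
  gcongr

end LateralH2

end UAV

theorem mainTheorem3 (S : UAV) (hg : 0 < S.g) (hmUAV : 0 < S.mUAV) (hmPL : 0 < S.mPL)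
    (hHxx : 0 < S.Hxx) (hHyy : 0 < S.Hyy) (hq : ∀ i, 0 < S.q i) (i : Fin 2) :
    -- the optimal control problem and the norm are well defined for all vertical positions
    (∀ zPOI zPL : ℝ, (∃! P, S.IsLatRiccati i zPOI zPL P) ∧
      IntegrableOn (S.latEnergy i zPOI zPL) (Set.Ioi 0)) ∧
    -- for each payload height, the norm is minimal exactly at `α = √(2g / q̂_i)`
    (∀ zPL zPOI : ℝ, S.alpha zPOI zPL = √(2 * S.g / S.qHat i zPL) →
      S.latH2 i zPOI zPL = √(2 * (2 * S.g * S.qHat i zPL) ^ (1 / 4 : ℝ)) ∧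
      ∀ zPOI' : ℝ, zPOI' ≠ zPOI → S.latH2 i zPOI zPL < S.latH2 i zPOI' zPL) ∧
    -- jointly in both heights, the norm is minimal exactly at `z_PL = 0`, `z_POI = √(2g / q̂_i)`
    (∀ zPOI zPL : ℝ, (zPOI, zPL) ≠ (√(2 * S.g / S.qHat i 0), 0) →
      S.latH2 i (√(2 * S.g / S.qHat i 0)) 0 < S.latH2 i zPOI zPL) := by
  have hqHat := UAV.qHat_pos hmUAV hmPL hHxx hHyy (hq i)
  have hmin {zPOI zPL : ℝ} := UAV.latH2_eq_iff (zPOI := zPOI) hg (hqHat zPL)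
  have hlt {zPOI zPL : ℝ} (hα : S.alpha zPOI zPL ≠ √(2 * S.g / S.qHat i zPL)) :
      √(2 * S.latRate i zPL) < S.latH2 i zPOI zPL :=
    (UAV.sqrt_two_mul_latRate_le_latH2 hg (hqHat zPL)).lt_of_ne' (hmin.not.2 hα)
  have hα₀ (zPOI : ℝ) : S.alpha zPOI 0 = zPOI := by simp [UAV.alpha]
  refine ⟨fun zPOI zPL => ⟨UAV.existsUnique_isLatRiccati hg (hqHat zPL),
    UAV.integrableOn_latEnergy hg (hqHat zPL)⟩, fun zPL zPOI hα => ⟨hmin.2 hα, ?_⟩, ?_⟩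
  · intro zPOI' hne
    rw [hmin.2 hα]
    refine hlt (hα ▸ fun h => hne ?_)
    simpa [UAV.alpha] using h
  · intro zPOI zPL hne
    rw [hmin.2 (hα₀ _)]
    rcases eq_or_ne zPL 0 with rfl | hzPL
    · exact hlt (by rw [hα₀]; rintro rfl; exact hne rfl)
    · have hρ := UAV.latRate_zero_lt_latRate hg hmUAV hmPL (hq i) (hqHat 0) hzPL
      exact (Real.sqrt_lt_sqrt (mul_nonneg zero_le_two (UAV.latRate_pos hg (hqHat 0)).le)
        (mul_lt_mul_of_pos_left hρ two_pos)).trans_le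
        (UAV.sqrt_two_mul_latRate_le_latH2 hg (hqHat zPL))
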